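/- Let $\alpha>0$ and let $F:(\alpha,\infty)\to\mathbb{R}$ be a convex Lipschitz function. Suppose there are $0\le\underline{\gamma}\le\overline{\gamma}<\infty$ such that every supporting line of the graph of $F$ (a line $y=at+b$ with $at+b\le F(t)$ for all $t>\alpha$ and equality for some $t>\alpha$) meets the vertical axis at a height $b\in[\underline{\gamma},\overline{\gamma}]$. Then there exist a finite non-empty set $\Lambda$ and a sequence of locally constant functions $\phi_n:\Lambda^{\mathbb{Z}}\to\mathbb{R}$, $n\ge 1$, on the full shift $\sigma:\Lambda^{\mathbb{Z}}\to\Lambda^{\mathbb{Z}}$, $(\sigma x)_i=x_{i+1}$ (in particular, on one fixed shift space of finite type), such that the pressures $$P(t\phi_n)=\lim_{m\to\infty}\frac1m\log\sum_{\sigma^m(x)=x}\exp\Big(\sum_{i=0}^{m-1}t\,\phi_n(\sigma^i x)\Big)$$ exist for all $n$ and all $t\in\mathbb{R}$, and $$\lim_{n\to\infty}P(t\phi_n)=F(t)\qquad\text{for every } t\in(\alpha,\infty).$$ Moreover, the convergence is uniform in $t$ on every bounded subset of $(\alpha,\infty)$. -/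

import Mathlib

open Set Filter Topology

/-- The left shift `(σ x) i = x (1 + i)` on the two-sided full shift space over the symbols `Λ`. -/
def leftShift {Λ : Type*} (x : ℤ → Λ) : ℤ → Λ := SymbolicDynamics.FullShift.shift (1 : ℤ) x

theorem leftShift_iterate {Λ : Type*} (m : ℕ) (x : ℤ → Λ) (i : ℤ) :
    (leftShift^[m] x) i = x (i + m) := by
  induction m generalizing i with
  | zero => simp
  | succ m ih =>
    rw [Function.iterate_succ_apply']
    change (leftShift^[m] x) (1 + i) = _
    rw [ih]
    congr 1
    push_cast
    ring

/-- Over finitely many symbols and for `m ≥ 1`, the equation `σ^m x = x` has finitely many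
solutions, so that the sums below are honest finite sums. -/
theorem finite_ptsOfPeriod_leftShift {Λ : Type*} [Finite Λ] {m : ℕ} (hm : 0 < m) :
    (Function.ptsOfPeriod (leftShift (Λ := Λ)) m).Finite := by
  have hinj : InjOn (fun (x : ℤ → Λ) (j : Fin m) => x ((j : ℕ) : ℤ))
      (Function.ptsOfPeriod (leftShift (Λ := Λ)) m) := by
    intro x hx y hy hxy
    have per : ∀ z ∈ Function.ptsOfPeriod (leftShift (Λ := Λ)) m,
        Function.Periodic z (m : ℤ) := by
      intro z hz i
      exact (leftShift_iterate m z i).symm.trans (congrFun hz i)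
    have hm' : (0 : ℤ) < m := by exact_mod_cast hm
    have red : ∀ z ∈ Function.ptsOfPeriod (leftShift (Λ := Λ)) m, ∀ i : ℤ,
        z i = z (i % m) := by
      intro z hz i
      have h := (per z hz).int_mul (i / m) (i % m)
      rw [← h]
      congr 1
      have := Int.emod_add_mul_ediv i m
      simp only [Int.cast_id]
      linarith [mul_comm (m : ℤ) (i / m)]
    funext i
    rw [red x hx i, red y hy i]
    have h0 := Int.emod_nonneg i hm'.ne'
    have h1 := Int.emod_lt_of_pos i hm'
    have := congrFun hxy ⟨(i % m).toNat, by omega⟩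
    simpa [Int.toNat_of_nonneg h0] using this
  exact Set.Finite.of_finite_image (Set.toFinite _) hinj

/-- `(1/m) log ∑_{σ^m x = x} exp (S_m φ x)`, where `S_m φ = ∑_{i < m} φ ∘ σ^i`. -/
noncomputable def pressureApprox {Λ : Type*} (φ : (ℤ → Λ) → ℝ) (m : ℕ) : ℝ :=
  (1 / (m : ℝ)) * Real.log (∑ᶠ x ∈ Function.ptsOfPeriod (leftShift (Λ := Λ)) m,
    Real.exp (birkhoffSum leftShift φ m x))

/-- The pressure of the potential `φ` on the full shift exists and equals `p`. -/
def HasPressure {Λ : Type*} (φ : (ℤ → Λ) → ℝ) (p : ℝ) : Prop :=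
  Tendsto (pressureApprox φ) atTop (𝓝 p)

/-- The pressure `P(φ) = lim_m (1/m) log ∑_{σ^m x = x} exp (S_m φ x)`. -/
noncomputable def pressure {Λ : Type*} (φ : (ℤ → Λ) → ℝ) : ℝ :=
  limUnder atTop (pressureApprox φ)

/-- The line `y = a * t + b` is a supporting line of the graph of `F` over `s`: it lies nowhere
above the graph and touches it at a point. It meets the vertical axis at height `b`. -/
def IsSupportingLine (F : ℝ → ℝ) (s : Set ℝ) (a b : ℝ) : Prop :=
  (∀ t ∈ s, a * t + b ≤ F t) ∧ ∃ t ∈ s, a * t + b = F t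

/-! A convex Lipschitz `F` is, up to `ε` on a bounded set, the maximum of finitely many supporting
lines `a i * t + b i`. Such a line is the pressure of about `exp ((k + 1) * b i)` freely
concatenated words of length `k + 1`, each of energy `(k + 1) * a i`: the height is entropy, so it
must be nonnegative, and its bound `γ₂` fixes an alphabet independent of `ε`. All lines are realised
together by disjoint families of words on one full shift. Each word starts with the marker `0`,
which does not recur in it, so a block can be charged without another block starting inside it. All
positions where no chosen word starts receive a very negative value `c`. Concatenating blocks bounds
the pressure below (`le_pressure_markerFun`). For the upper bound, a sequence either starts with a
block or pays `c` for its first symbol, which gives a linear recursion with the geometric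
supersolution `exp (F t + ε) ^ m` (`pressure_markerFun_le`). For large `k` the number of lines and
the rounding of word counts cost at most `ε`. -/

/-! ### Words and sums over words -/

/-- The word `w`, padded by the symbol `0`. -/
def wordExt {q : ℕ} (m : ℕ) (w : Fin m → Fin (q + 1)) : ℕ → Fin (q + 1) :=
  fun j => if h : j < m then w ⟨j, h⟩ else 0

/-- The sum of `f` over all words of length `m`, padded by the symbol `0`. -/
noncomputable def wordSum {q : ℕ} (m : ℕ) (f : (ℕ → Fin (q + 1)) → ℝ) : ℝ :=
  ∑ w : Fin m → Fin (q + 1), f (wordExt m w)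

/-- The first `m` symbols of `u`, followed by `v`. -/
def splice {X : Type*} (m : ℕ) (u v : ℕ → X) : ℕ → X :=
  fun j => if j < m then u j else v (j - m)

/-- The Birkhoff sums of `g` along the one-sided shift. -/
noncomputable def seqSum {X : Type*} (g : (ℕ → X) → ℝ) (m : ℕ) (u : ℕ → X) : ℝ :=
  ∑ i ∈ Finset.range m, g (fun j => u (j + i))

/-- `g u` depends only on the first `l` symbols of `u`. -/
def DependsOnFirst {X : Type*} (l : ℕ) (g : (ℕ → X) → ℝ) : Prop :=
  ∀ u v : ℕ → X, (∀ j < l, u j = v j) → g u = g v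

theorem splice_add {X : Type*} (m : ℕ) (u v : ℕ → X) : (fun j => splice m u v (j + m)) = v := by
  funext j
  simp [splice]

/-- Splicing two padded words gives exactly the padded concatenation, so later recursions carry no
boundary error. -/
theorem wordSum_add {q : ℕ} (m n : ℕ) (f : (ℕ → Fin (q + 1)) → ℝ) :
    wordSum (m + n) f = wordSum m (fun u => wordSum n (fun v => f (splice m u v))) := by
  unfold wordSum
  rw [← (Fin.appendEquiv m n).sum_comp, Fintype.sum_prod_type]
  refine Finset.sum_congr rfl fun w _ => Finset.sum_congr rfl fun w' _ => ?_
  congr 1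
  funext j
  simp only [wordExt, splice, Fin.appendEquiv, Equiv.coe_fn_mk]
  by_cases h : j < m
  · have h' : j < m + n := by omega
    simp only [h, h', dite_true, if_true]
    exact Fin.append_left w w' ⟨j, h⟩
  · by_cases h' : j < m + n
    · have h'' : j - m < n := by omega
      simp only [h, h', h'', dite_true, if_false]
      rw [← Fin.append_right w w' ⟨j - m, h''⟩]
      congr 1
      ext
      simp
      omega
    · have h'' : ¬ j - m < n := by omega
      simp [h, h', h'']

theorem wordSum_mono {q m : ℕ} {f g : (ℕ → Fin (q + 1)) → ℝ} (h : ∀ u, f u ≤ g u) :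
    wordSum m f ≤ wordSum m g := Finset.sum_le_sum fun _ _ => h _

theorem wordSum_pos {q m : ℕ} {f : (ℕ → Fin (q + 1)) → ℝ} (h : ∀ u, 0 < f u) :
    0 < wordSum m f := Finset.sum_pos (fun _ _ => h _) Finset.univ_nonempty

theorem wordSum_mul_left {q m : ℕ} (a : ℝ) (f : (ℕ → Fin (q + 1)) → ℝ) :
    wordSum m (fun u => a * f u) = a * wordSum m f := (Finset.mul_sum _ _ _).symm

theorem wordSum_mul_right {q m : ℕ} (a : ℝ) (f : (ℕ → Fin (q + 1)) → ℝ) :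
    wordSum m (fun u => f u * a) = wordSum m f * a := (Finset.sum_mul _ _ _).symm

theorem wordSum_sum {q m : ℕ} (f g : (ℕ → Fin (q + 1)) → ℝ) :
    wordSum m (fun u => f u + g u) = wordSum m f + wordSum m g := Finset.sum_add_distrib

theorem wordSum_mul_shift {q l m : ℕ} (h f : (ℕ → Fin (q + 1)) → ℝ) (hh : DependsOnFirst l h) :
    wordSum (l + m) (fun u => h u * f (fun j => u (j + l))) = wordSum l h * wordSum m f := by
  rw [wordSum_add, ← wordSum_mul_right]
  unfold wordSum
  refine Finset.sum_congr rfl fun w _ => ?_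
  simp only [Finset.mul_sum]
  refine Finset.sum_congr rfl fun w' _ => ?_
  rw [splice_add]
  congr 1
  exact hh _ _ fun j hj => by simp [splice, hj]

/-! ### Birkhoff sums of potentials of finite range -/

theorem seqSum_add {X : Type*} (g : (ℕ → X) → ℝ) (m n : ℕ) (u : ℕ → X) :
    seqSum g (m + n) u = seqSum g m u + seqSum g n (fun j => u (j + m)) := by
  unfold seqSum
  rw [Finset.sum_range_add]
  congr 1
  refine Finset.sum_congr rfl fun i _ => ?_
  congr 1
  funext j
  congr 1
  omega

theorem seqSum_smul {X : Type*} (g : (ℕ → X) → ℝ) (t : ℝ) (m : ℕ) (u : ℕ → X) :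
    seqSum (fun u => t * g u) m u = t * seqSum g m u := (Finset.mul_sum _ _ _).symm

theorem abs_seqSum_le {X : Type*} {g : (ℕ → X) → ℝ} {M : ℝ} (hM : ∀ u, |g u| ≤ M) (m : ℕ)
    (u : ℕ → X) : |seqSum g m u| ≤ m * M := by
  refine (Finset.abs_sum_le_sum_abs _ _).trans ?_
  refine (Finset.sum_le_sum fun i _ => hM _).trans ?_
  simp

/-- Bounded distortion. -/
theorem abs_seqSum_sub_le {X : Type*} {l : ℕ} {g : (ℕ → X) → ℝ} (hg : DependsOnFirst l g) {M : ℝ}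
    (hM : ∀ u, |g u| ≤ M) {m : ℕ} {u v : ℕ → X} (huv : ∀ j < m, u j = v j) :
    |seqSum g m u - seqSum g m v| ≤ l * (2 * M) := by
  have hM0 : 0 ≤ M := (abs_nonneg _).trans (hM u)
  unfold seqSum
  rw [← Finset.sum_sub_distrib]
  refine (Finset.abs_sum_le_sum_abs _ _).trans ?_
  -- Only windows reaching past position `m` can tell `u` from `v`, and at most `l` of them do.
  have h1 : ∀ i ∈ Finset.range m, |g (fun j => u (j + i)) - g (fun j => v (j + i))| ≤
      if m < l + i then 2 * M else 0 := by
    intro i _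
    split_ifs with h
    · refine (abs_sub _ _).trans ?_
      linarith [hM (fun j => u (j + i)), hM (fun j => v (j + i))]
    · rw [hg (fun j => u (j + i)) (fun j => v (j + i)) fun j hj => huv _ (by omega)]
      simp
  refine (Finset.sum_le_sum h1).trans ?_
  rw [← Finset.sum_filter, Finset.sum_const, nsmul_eq_mul]
  refine mul_le_mul_of_nonneg_right ?_ (by positivity)
  have h2 : (Finset.range m).filter (fun i => m < l + i) ⊆ Finset.Ico (m - l) m := by
    intro i hi
    simp only [Finset.mem_filter, Finset.mem_range, Finset.mem_Ico] at hi ⊢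
    omega
  have h3 := Finset.card_le_card h2
  rw [Nat.card_Ico] at h3
  exact_mod_cast h3.trans (by omega)

/-! ### Existence of the pressure -/

/-- The partition function of `g` over padded words of length `m`. -/
noncomputable def wordPartition {q : ℕ} (g : (ℕ → Fin (q + 1)) → ℝ) (m : ℕ) : ℝ :=
  wordSum m (fun u => Real.exp (seqSum g m u))

theorem wordPartition_pos {q : ℕ} (g : (ℕ → Fin (q + 1)) → ℝ) (m : ℕ) :
    0 < wordPartition g m := wordSum_pos fun _ => Real.exp_pos _

theorem wordPartition_add_le {q l : ℕ} {g : (ℕ → Fin (q + 1)) → ℝ} (hg : DependsOnFirst l g)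
    {M : ℝ} (hM : ∀ u, |g u| ≤ M) (m n : ℕ) :
    wordPartition g (m + n) ≤
      Real.exp (l * (2 * M)) * wordPartition g m * wordPartition g n := by
  unfold wordPartition
  rw [wordSum_add, ← wordSum_mul_left (m := m), ← wordSum_mul_right (m := m)]
  refine wordSum_mono fun u => ?_
  rw [← wordSum_mul_left]
  refine wordSum_mono fun v => ?_
  rw [seqSum_add, splice_add, Real.exp_add, ← Real.exp_add (l * (2 * M))]
  refine mul_le_mul_of_nonneg_right (Real.exp_le_exp.2 ?_) (Real.exp_pos _).le
  have := abs_le.1 (abs_seqSum_sub_le hg hM (m := m) (u := splice m u v) (v := u)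
    fun j hj => by simp [splice, hj])
  linarith [this.2]

/-- Fekete's lemma: adding the distortion constant `D` to the logarithm makes it subadditive, and `D
/ m` vanishes in the limit. -/
theorem exists_tendsto_log_wordPartition {q l : ℕ} {g : (ℕ → Fin (q + 1)) → ℝ}
    (hg : DependsOnFirst l g) {M : ℝ} (hM : ∀ u, |g u| ≤ M) :
    ∃ p, Tendsto (fun m : ℕ => Real.log (wordPartition g m) / m) atTop (𝓝 p) := by
  set D : ℝ := l * (2 * M) with hD
  have hM0 : 0 ≤ M := (abs_nonneg _).trans (hM 0)
  have hD0 : 0 ≤ D := by positivity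
  have hsub : Subadditive fun m => Real.log (wordPartition g m) + D := by
    intro m n
    have h := Real.log_le_log (wordPartition_pos g (m + n)) (wordPartition_add_le hg hM m n)
    rw [Real.log_mul (mul_pos (Real.exp_pos _) (wordPartition_pos g m)).ne'
      (wordPartition_pos g n).ne',
      Real.log_mul (Real.exp_pos _).ne' (wordPartition_pos g m).ne', Real.log_exp] at h
    simp only
    linarith
  have hbdd : BddBelow (range fun m : ℕ => (Real.log (wordPartition g m) + D) / m) := by
    refine ⟨-M, ?_⟩
    rintro _ ⟨m, rfl⟩
    rcases Nat.eq_zero_or_pos m with rfl | hm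
    · simpa using hM0
    have hm' : (0 : ℝ) < m := by exact_mod_cast hm
    simp only
    rw [le_div_iff₀ hm']
    have h1 : Real.exp (-(m * M)) ≤ wordPartition g m := by
      refine le_trans ?_ (Finset.single_le_sum (f := fun w : Fin m → Fin (q + 1) =>
        Real.exp (seqSum g m (wordExt m w))) (fun _ _ => (Real.exp_pos _).le)
        (Finset.mem_univ (fun _ => 0)))
      exact Real.exp_le_exp.2 (abs_le.1 (abs_seqSum_le hM m _)).1
    have h2 := Real.log_le_log (Real.exp_pos _) h1
    rw [Real.log_exp] at h2
    linarith
  refine ⟨hsub.lim, ?_⟩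
  have h := (hsub.tendsto_lim hbdd).sub (tendsto_const_div_atTop_nhds_zero_nat D)
  rw [sub_zero] at h
  refine h.congr fun m => ?_
  rw [← sub_div, add_sub_cancel_right]

/-- The periodic bi-infinite sequence with period `w`. -/
def periodicExt {X : Type*} {m : ℕ} (hm : 0 < m) (w : Fin m → X) : ℤ → X :=
  fun i => w ⟨(i % m).toNat, by
    have h0 := Int.emod_nonneg i (b := (m : ℤ)) (by omega)
    have h1 := Int.emod_lt_of_pos i (b := (m : ℤ)) (by omega)
    omega⟩

theorem bijOn_periodicExt {X : Type*} {m : ℕ} (hm : 0 < m) :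
    BijOn (periodicExt (X := X) hm) univ (Function.ptsOfPeriod (leftShift (Λ := X)) m) := by
  refine ⟨fun w _ => ?_, fun w _ w' _ h => ?_, fun x hx => ?_⟩
  · change leftShift^[m] _ = _
    funext i
    rw [leftShift_iterate]
    simp [periodicExt]
  · funext i
    have := congrFun h (i : ℕ)
    have h1 : ((i : ℕ) : ℤ) % (m : ℤ) = (i : ℕ) := Int.emod_eq_of_lt (by omega) (by omega)
    simpa [periodicExt, h1] using this
  · refine ⟨fun j => x (j : ℕ), mem_univ _, ?_⟩
    have per : Function.Periodic x (m : ℤ) := fun i =>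
      (leftShift_iterate m x i).symm.trans (congrFun hx i)
    funext i
    have h0 := Int.emod_nonneg i (b := (m : ℤ)) (by omega)
    simp only [periodicExt, Int.toNat_of_nonneg h0]
    have h := per.int_mul (i / m) (i % m)
    rw [← h]
    congr 1
    have := Int.emod_add_mul_ediv i m
    simp only [Int.cast_id]
    linarith [mul_comm (m : ℤ) (i / m)]

theorem birkhoffSum_leftShift {X : Type*} (g : (ℕ → X) → ℝ) (m : ℕ) (x : ℤ → X) :
    birkhoffSum leftShift (fun x => g fun j => x j) m x = seqSum g m (fun j => x j) := by
  unfold birkhoffSum seqSum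
  refine Finset.sum_congr rfl fun i _ => congrArg g ?_
  funext j
  rw [leftShift_iterate]
  norm_cast

/-- Points of period `m` correspond to words of length `m`; periodic and padded extensions agree on
the first `m` symbols, so bounded distortion compares the two sums term by term. -/
theorem abs_pressureApprox_sub_le {q l : ℕ} {g : (ℕ → Fin (q + 1)) → ℝ} (hg : DependsOnFirst l g)
    {M : ℝ} (hM : ∀ u, |g u| ≤ M) {m : ℕ} (hm : 0 < m) :
    |pressureApprox (fun x : ℤ → Fin (q + 1) => g fun j => x j) m -
      Real.log (wordPartition g m) / m| ≤ l * (2 * M) / m := by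
  set D : ℝ := l * (2 * M) with hD
  have hm' : (0 : ℝ) < m := by exact_mod_cast hm
  unfold pressureApprox
  have hZ : (∑ᶠ x ∈ Function.ptsOfPeriod (leftShift (Λ := Fin (q + 1))) m,
      Real.exp (birkhoffSum leftShift (fun x : ℤ → Fin (q + 1) => g fun j => x j) m x)) =
      ∑ w : Fin m → Fin (q + 1), Real.exp (seqSum g m fun j => periodicExt hm w j) := by
    rw [← finsum_mem_eq_of_bijOn (periodicExt hm) (bijOn_periodicExt hm)
      (fun w _ => rfl), finsum_mem_univ, finsum_eq_sum_of_fintype]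
    simp only [birkhoffSum_leftShift]
  rw [hZ]
  have hdist : ∀ w : Fin m → Fin (q + 1), |seqSum g m (fun j => periodicExt hm w j) -
      seqSum g m (wordExt m w)| ≤ D := fun w => by
    refine abs_seqSum_sub_le hg hM fun j hj => ?_
    have h1 : (j : ℤ) % (m : ℤ) = j := Int.emod_eq_of_lt (by omega) (by omega)
    simp [periodicExt, wordExt, hj, h1]
  set Z := ∑ w : Fin m → Fin (q + 1), Real.exp (seqSum g m fun j => periodicExt hm w j)
  have hZ0 : 0 < Z := Finset.sum_pos (fun _ _ => Real.exp_pos _) Finset.univ_nonempty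
  have hQ0 := wordPartition_pos g m
  have h1 : Z ≤ Real.exp D * wordPartition g m := by
    unfold wordPartition
    rw [← wordSum_mul_left]
    refine Finset.sum_le_sum fun w _ => ?_
    simp only [← Real.exp_add]
    exact Real.exp_le_exp.2 (by linarith [(abs_le.1 (hdist w)).2])
  have h2 : wordPartition g m ≤ Real.exp D * Z := by
    rw [Finset.mul_sum]
    refine Finset.sum_le_sum fun w _ => ?_
    rw [← Real.exp_add]
    exact Real.exp_le_exp.2 (by linarith [(abs_le.1 (hdist w)).1])
  have h1' := Real.log_le_log hZ0 h1
  have h2' := Real.log_le_log hQ0 h2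
  rw [Real.log_mul (Real.exp_pos _).ne' hQ0.ne', Real.log_exp] at h1'
  rw [Real.log_mul (Real.exp_pos _).ne' hZ0.ne', Real.log_exp] at h2'
  rw [one_div_mul_eq_div, ← sub_div, abs_div, abs_of_pos hm']
  gcongr
  exact abs_le.2 ⟨by linarith, by linarith⟩

theorem tendsto_log_wordPartition {q l : ℕ} {g : (ℕ → Fin (q + 1)) → ℝ}
    (hg : DependsOnFirst l g) {M : ℝ} (hM : ∀ u, |g u| ≤ M) :
    HasPressure (fun x : ℤ → Fin (q + 1) => g fun j => x j)
        (pressure fun x : ℤ → Fin (q + 1) => g fun j => x j) ∧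
      Tendsto (fun m : ℕ => Real.log (wordPartition g m) / m) atTop
        (𝓝 (pressure fun x : ℤ → Fin (q + 1) => g fun j => x j)) := by
  obtain ⟨p, hp⟩ := exists_tendsto_log_wordPartition hg hM
  have h0 : Tendsto (fun m : ℕ => pressureApprox (fun x : ℤ → Fin (q + 1) => g fun j => x j) m -
      Real.log (wordPartition g m) / m) atTop (𝓝 0) := by
    refine squeeze_zero_norm' ?_ (tendsto_const_div_atTop_nhds_zero_nat (l * (2 * M)))
    filter_upwards [eventually_gt_atTop 0] with m hm
    exact abs_pressureApprox_sub_le hg hM hm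
  have h1 := h0.add hp
  simp only [sub_add_cancel, zero_add] at h1
  have h2 : (pressure fun x : ℤ → Fin (q + 1) => g fun j => x j) = p := h1.limUnder_eq
  rw [h2]
  exact ⟨h1, hp⟩

/-! ### Marker potentials -/

/-- A set of words of length `k + 1` that begin with the marker `0` and contain no other one. -/
def IsMarked {q k : ℕ} (G : Finset (Fin (k + 1) → Fin (q + 1))) : Prop :=
  ∀ w ∈ G, ∀ j, w j = 0 ↔ j = 0

/-- The weight of the first symbol: the default value `c` is paid everywhere, and at the
beginning of a word `w ∈ G` it is corrected so that the total over `w` is `(k + 1) * a w`. -/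
noncomputable def markerWeight {q k : ℕ} (G : Finset (Fin (k + 1) → Fin (q + 1)))
    (a : (Fin (k + 1) → Fin (q + 1)) → ℝ) (c : ℝ) (w : Fin (k + 1) → Fin (q + 1)) : ℝ :=
  c + if w ∈ G then ((k : ℝ) + 1) * (a w - c) else 0

/-- The potential on one-sided sequences given by `markerWeight`. -/
noncomputable def markerPotential {q k : ℕ} (G : Finset (Fin (k + 1) → Fin (q + 1)))
    (a : (Fin (k + 1) → Fin (q + 1)) → ℝ) (c : ℝ) (u : ℕ → Fin (q + 1)) : ℝ :=
  markerWeight G a c fun j => u j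

section MarkerPotential

variable {q k : ℕ} {G : Finset (Fin (k + 1) → Fin (q + 1))}
  {a : (Fin (k + 1) → Fin (q + 1)) → ℝ} {c : ℝ}

theorem dependsOnFirst_comp_prefix {X : Type*} {l : ℕ} (h : (Fin l → X) → ℝ) :
    DependsOnFirst l (fun u => h fun j => u j) := by
  intro u v huv
  exact congrArg h (funext fun j => huv j j.2)

theorem wordSum_comp_prefix {l : ℕ} (h : (Fin l → Fin (q + 1)) → ℝ) :
    wordSum l (fun u => h fun j => u j) = ∑ w, h w := by
  unfold wordSum
  refine Finset.sum_congr rfl fun w _ => congrArg h (funext fun j => ?_)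
  simp [wordExt]

/-- No word of `G` starts at an interior position, since that would need a second marker; those
positions pay `c`, which the correction at the first symbol cancels. -/
theorem seqSum_markerPotential_of_mem (hG : IsMarked G) {u : ℕ → Fin (q + 1)}
    (hu : (fun j : Fin (k + 1) => u j) ∈ G) :
    seqSum (markerPotential G a c) (k + 1) u = ((k : ℝ) + 1) * a fun j => u j := by
  unfold seqSum
  rw [Finset.sum_range_succ']
  have h1 : ∀ i ∈ Finset.range k, markerPotential G a c (fun j => u (j + (i + 1))) = c := by
    intro i hi
    have hn : (fun j : Fin (k + 1) => u (j + (i + 1))) ∉ G := by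
      intro h
      have h2 := (hG _ h 0).2 rfl
      have h3 := (hG _ hu ⟨i + 1, by simpa using hi⟩).1 (by simpa using h2)
      simp [Fin.ext_iff] at h3
    simp [markerPotential, markerWeight, hn]
  rw [Finset.sum_congr rfl h1]
  simp only [markerPotential, markerWeight, add_zero, hu, if_true, Finset.sum_const,
    Finset.card_range, nsmul_eq_mul]
  ring

theorem markerPotential_of_notMem {u : ℕ → Fin (q + 1)}
    (hu : (fun j : Fin (k + 1) => u j) ∉ G) : markerPotential G a c u = c := by
  simp [markerPotential, markerWeight, hu]

/-- The partition function of the words in `G`. -/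
noncomputable def blockSum (G : Finset (Fin (k + 1) → Fin (q + 1)))
    (a : (Fin (k + 1) → Fin (q + 1)) → ℝ) (t : ℝ) : ℝ :=
  ∑ w ∈ G, Real.exp (t * (((k : ℝ) + 1) * a w))

theorem wordSum_block_mul (t : ℝ) (m : ℕ) (f : (ℕ → Fin (q + 1)) → ℝ) :
    wordSum (k + 1 + m) (fun u => (if (fun j : Fin (k + 1) => u j) ∈ G then
      Real.exp (t * (((k : ℝ) + 1) * a fun j => u j)) else 0) * f (fun j => u (j + (k + 1)))) =
      blockSum G a t * wordSum m f := by
  rw [wordSum_mul_shift (l := k + 1) (m := m) _ f (dependsOnFirst_comp_prefix fun w => if w ∈ G then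
    Real.exp (t * (((k : ℝ) + 1) * a w)) else 0),
    wordSum_comp_prefix fun w => if w ∈ G then Real.exp (t * (((k : ℝ) + 1) * a w)) else 0]
  simp [blockSum]

theorem blockSum_mul_le_wordPartition (hG : IsMarked G) (t : ℝ) (m : ℕ) :
    blockSum G a t * wordPartition (fun u => t * markerPotential G a c u) m ≤
      wordPartition (fun u => t * markerPotential G a c u) (k + 1 + m) := by
  unfold wordPartition
  rw [← wordSum_block_mul]
  refine wordSum_mono fun u => ?_
  split_ifs with hu
  · rw [seqSum_add, seqSum_smul, seqSum_smul, seqSum_markerPotential_of_mem hG hu, Real.exp_add]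
  · rw [zero_mul]
    positivity

/-- Either the sequence starts with a word of `G`, which splits off with its full weight, or its
first symbol, one of `q + 1`, splits off with weight `exp (t * c)`. -/
theorem wordPartition_le (hG : IsMarked G) (t : ℝ) (m : ℕ) :
    wordPartition (fun u => t * markerPotential G a c u) (k + 1 + m) ≤
      blockSum G a t * wordPartition (fun u => t * markerPotential G a c u) m +
      (q + 1) * Real.exp (t * c) *
        wordPartition (fun u => t * markerPotential G a c u) (k + m) := by
  set g := fun u => t * markerPotential G a c u with hg
  have h1 : wordSum (k + 1 + m) (fun u : ℕ → Fin (q + 1) =>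
      Real.exp (t * c) * Real.exp (seqSum g (k + m) fun j => u (j + 1))) =
      (q + 1) * Real.exp (t * c) * wordPartition g (k + m) := by
    rw [show k + 1 + m = 1 + (k + m) by ring]
    have h2 := wordSum_mul_shift (l := 1) (m := k + m) (fun _ => Real.exp (t * c))
      (fun u : ℕ → Fin (q + 1) => Real.exp (seqSum g (k + m) u)) (fun _ _ _ => rfl)
    rw [h2]
    simp [wordPartition, wordSum]
  rw [← h1]
  unfold wordPartition
  rw [← wordSum_block_mul, ← wordSum_sum]
  refine wordSum_mono fun u => ?_
  split_ifs with hu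
  · rw [seqSum_add, hg, seqSum_smul, seqSum_markerPotential_of_mem hG hu, Real.exp_add]
    exact le_add_of_nonneg_right (by positivity)
  · rw [zero_mul, zero_add, ← Real.exp_add, show k + 1 + m = 1 + (k + m) by ring, seqSum_add]
    have : seqSum g 1 u = t * c := by
      simp [seqSum, hg, markerPotential_of_notMem hu]
    rw [this]

/-- The hypothesis says that `r ^ m` is a supersolution of the recursion; `C` is chosen to dominate
the `k + 1` initial values. -/
theorem exists_wordPartition_le_pow (hG : IsMarked G) {t r : ℝ} (hr : 0 < r)
    (h : blockSum G a t + (q + 1) * Real.exp (t * c) * r ^ k ≤ r ^ (k + 1)) :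
    ∃ C, 0 < C ∧ ∀ m, wordPartition (fun u => t * markerPotential G a c u) m ≤ C * r ^ m := by
  set Q := wordPartition (fun u => t * markerPotential G a c u) with hQ
  have hpos : ∀ i, 0 < Q i / r ^ i := fun i => div_pos (wordPartition_pos _ _) (by positivity)
  refine ⟨∑ i ∈ Finset.range (k + 1), Q i / r ^ i,
    Finset.sum_pos (fun i _ => hpos i) (by simp), ?_⟩
  set C := ∑ i ∈ Finset.range (k + 1), Q i / r ^ i with hC
  have hC0 : 0 < C := Finset.sum_pos (fun i _ => hpos i) (by simp)
  intro m
  induction m using Nat.strong_induction_on with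
  | _ m ih =>
    rcases lt_or_ge m (k + 1) with hm | hm
    · rw [← div_le_iff₀ (by positivity)]
      exact Finset.single_le_sum (f := fun i => Q i / r ^ i) (fun i _ => (hpos i).le)
        (Finset.mem_range.2 hm)
    · obtain ⟨n, rfl⟩ := Nat.exists_eq_add_of_le hm
      have hA : 0 ≤ blockSum G a t := Finset.sum_nonneg fun _ _ => (Real.exp_pos _).le
      calc Q (k + 1 + n) ≤ blockSum G a t * Q n + (q + 1) * Real.exp (t * c) * Q (k + n) :=
            wordPartition_le hG t n
        _ ≤ blockSum G a t * (C * r ^ n) + (q + 1) * Real.exp (t * c) * (C * r ^ (k + n)) := by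
            gcongr
            · exact ih n (by omega)
            · exact ih (k + n) (by omega)
        _ = (blockSum G a t + (q + 1) * Real.exp (t * c) * r ^ k) * (C * r ^ n) := by ring
        _ ≤ r ^ (k + 1) * (C * r ^ n) := by gcongr
        _ = C * r ^ (k + 1 + n) := by ring

theorem pow_blockSum_le_wordPartition (hG : IsMarked G) (t : ℝ) (n : ℕ) :
    blockSum G a t ^ n ≤
      wordPartition (fun u => t * markerPotential G a c u) ((k + 1) * n) := by
  induction n with
  | zero => simp [wordPartition, wordSum, seqSum]
  | succ n ih =>
    have hA : 0 ≤ blockSum G a t := Finset.sum_nonneg fun _ _ => (Real.exp_pos _).le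
    rw [pow_succ', show (k + 1) * (n + 1) = k + 1 + (k + 1) * n by ring]
    exact (mul_le_mul_of_nonneg_left ih hA).trans (blockSum_mul_le_wordPartition hG t _)

theorem exists_abs_markerPotential_le (G : Finset (Fin (k + 1) → Fin (q + 1)))
    (a : (Fin (k + 1) → Fin (q + 1)) → ℝ) (c t : ℝ) :
    ∃ M, ∀ u, |t * markerPotential G a c u| ≤ M :=
  ⟨∑ w, |t * markerWeight G a c w|, fun u => Finset.single_le_sum
    (f := fun w => |t * markerWeight G a c w|) (fun _ _ => abs_nonneg _)
    (Finset.mem_univ fun j : Fin (k + 1) => u j)⟩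

theorem dependsOnFirst_markerPotential (t : ℝ) :
    DependsOnFirst (k + 1) (fun u => t * markerPotential G a c u) :=
  dependsOnFirst_comp_prefix fun w => t * markerWeight G a c w

/-- The marker potential on the two-sided full shift. -/
noncomputable def markerFun (G : Finset (Fin (k + 1) → Fin (q + 1)))
    (a : (Fin (k + 1) → Fin (q + 1)) → ℝ) (c : ℝ) : LocallyConstant (ℤ → Fin (q + 1)) ℝ where
  toFun x := markerPotential G a c fun j => x j
  isLocallyConstant := by
    have h : Continuous fun (x : ℤ → Fin (q + 1)) (j : Fin (k + 1)) => x ((j : ℕ) : ℤ) := by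
      fun_prop
    exact (IsLocallyConstant.of_discrete (markerWeight G a c)).comp_continuous h

theorem hasPressure_markerFun (t : ℝ) :
    HasPressure (fun x => t * markerFun G a c x) (pressure fun x => t * markerFun G a c x) := by
  obtain ⟨M, hM⟩ := exists_abs_markerPotential_le G a c t
  exact (tendsto_log_wordPartition (dependsOnFirst_markerPotential t) hM).1

theorem tendsto_pressure_markerFun (t : ℝ) :
    Tendsto (fun m : ℕ => Real.log (wordPartition (fun u => t * markerPotential G a c u) m) / m)
      atTop (𝓝 (pressure fun x => t * markerFun G a c x)) := by
  obtain ⟨M, hM⟩ := exists_abs_markerPotential_le G a c t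
  exact (tendsto_log_wordPartition (dependsOnFirst_markerPotential t) hM).2

theorem pressure_markerFun_le (hG : IsMarked G) {t r : ℝ} (hr : 0 < r)
    (h : blockSum G a t + (q + 1) * Real.exp (t * c) * r ^ k ≤ r ^ (k + 1)) :
    (pressure fun x => t * markerFun G a c x) ≤ Real.log r := by
  obtain ⟨C, hC, hQ⟩ := exists_wordPartition_le_pow hG hr h
  have h1 : Tendsto (fun m : ℕ => Real.log C / m + Real.log r) atTop (𝓝 (0 + Real.log r)) :=
    (tendsto_const_div_atTop_nhds_zero_nat _).add_const _
  rw [zero_add] at h1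
  refine le_of_tendsto_of_tendsto (tendsto_pressure_markerFun t) h1 ?_
  filter_upwards [eventually_gt_atTop 0] with m hm
  have hm' : (0 : ℝ) < m := by exact_mod_cast hm
  have h2 := Real.log_le_log (wordPartition_pos _ _) (hQ m)
  rw [Real.log_mul hC.ne' (by positivity), Real.log_pow] at h2
  rw [div_le_iff₀ hm', add_mul, div_mul_cancel₀ _ hm'.ne']
  linarith

theorem le_pressure_markerFun (hG : IsMarked G) {t s : ℝ}
    (h : Real.exp (((k : ℝ) + 1) * s) ≤ blockSum G a t) :
    s ≤ pressure fun x => t * markerFun G a c x := by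
  -- As the limit is known to exist, it suffices to test lengths that are multiples of the block
  -- length.
  have hsub : Tendsto (fun n : ℕ => (k + 1) * n) atTop atTop :=
    tendsto_id.const_mul_atTop' (by omega)
  refine ge_of_tendsto ((tendsto_pressure_markerFun t).comp hsub) ?_
  filter_upwards [eventually_gt_atTop 0] with n hn
  have hn' : (0 : ℝ) < n := by exact_mod_cast hn
  have h1 : Real.exp (((k : ℝ) + 1) * s) ^ n ≤
      wordPartition (fun u => t * markerPotential G a c u) ((k + 1) * n) :=
    (pow_le_pow_left₀ (Real.exp_pos _).le h n).trans (pow_blockSum_le_wordPartition hG t n)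
  have h2 := Real.log_le_log (by positivity) h1
  rw [Real.log_pow, Real.log_exp] at h2
  simp only [Function.comp]
  rw [le_div_iff₀ (by positivity)]
  push_cast
  linarith

end MarkerPotential

/-! ### Approximation of convex functions by pressures -/

/-- There are `q ^ k` words consisting of the marker followed by `k` nonzero symbols, enough to give
each index its own word. -/
theorem exists_marked_blockSum_eq {q k : ℕ} {ι : Type*} [Fintype ι]
    (hcard : Fintype.card ι ≤ q ^ k) (s : ι → ℝ) :
    ∃ (G : Finset (Fin (k + 1) → Fin (q + 1))) (a : (Fin (k + 1) → Fin (q + 1)) → ℝ),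
      IsMarked G ∧ ∀ t, blockSum G a t = ∑ i, Real.exp (t * (((k : ℝ) + 1) * s i)) := by
  have hc : Fintype.card ι ≤ Fintype.card (Fin k → Fin q) := by simpa using hcard
  obtain ⟨e⟩ := Function.Embedding.nonempty_of_card_le hc
  let f : ι ↪ (Fin (k + 1) → Fin (q + 1)) :=
    ⟨fun i => Fin.cons 0 fun j => (e i j).succ, fun i i' h => e.injective <| funext fun j => by
      have := congrFun h j.succ
      simpa using this⟩
  refine ⟨Finset.univ.map f, Function.extend f s 0, ?_, fun t => ?_⟩
  · intro w hw j
    obtain ⟨i, -, rfl⟩ := Finset.mem_map.1 hw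
    refine Fin.cases ?_ (fun j => ?_) j
    · exact iff_of_true rfl rfl
    · exact iff_of_false (Fin.succ_ne_zero _) (Fin.succ_ne_zero _)
  · simp [blockSum, f.injective.extend_apply]

/-! ### Supporting lines of convex Lipschitz functions -/

theorem ConvexOn.exists_isSupportingLine {F : ℝ → ℝ} {s : Set ℝ} (hF : ConvexOn ℝ s F) {x : ℝ}
    (hx : x ∈ interior s) : ∃ a b, IsSupportingLine F s a b ∧ a * x + b = F x := by
  set a := derivWithin F (Ioi x) x with ha
  refine ⟨a, F x - a * x, ⟨fun y hy => ?_, x, interior_subset hx, by ring⟩, by ring⟩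
  rcases lt_trichotomy x y with h | rfl | h
  · have h1 := hF.rightDeriv_le_slope_of_mem_interior hx hy h
    rw [slope_def_field, le_div_iff₀ (by linarith)] at h1
    linarith
  · linarith
  · have h1 := hF.slope_le_leftDeriv_of_mem_interior hy hx h
    have h2 := h1.trans (hF.leftDeriv_le_rightDeriv_of_mem_interior hx)
    rw [slope_def_field, div_le_iff₀ (by linarith)] at h2
    linarith

theorem IsSupportingLine.abs_slope_le {F : ℝ → ℝ} {s : Set ℝ} (hs : IsOpen s) {L : NNReal}
    (hF : LipschitzOnWith L F s) {a b : ℝ} (h : IsSupportingLine F s a b) : |a| ≤ L := by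
  obtain ⟨hle, x, hx, hxe⟩ := h
  obtain ⟨ε, hε, hball⟩ := Metric.isOpen_iff.1 hs x hx
  have key : ∀ d, |d| = ε / 2 → a * d ≤ L * |d| := by
    intro d hd
    have hm : x + d ∈ s := hball (by
      rw [Metric.mem_ball, Real.dist_eq, add_sub_cancel_left, hd]
      linarith)
    have h1 := hF.dist_le_mul _ hm _ hx
    rw [Real.dist_eq, Real.dist_eq, add_sub_cancel_left] at h1
    have h2 := le_abs_self (F (x + d) - F x)
    have h3 := hle _ hm
    linarith
  have hp : |ε / 2| = ε / 2 := abs_of_pos (by linarith)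
  have h1 := key (ε / 2) hp
  have h2 := key (-(ε / 2)) (by rw [abs_neg, hp])
  rw [abs_neg] at h2
  rw [hp] at h1 h2
  exact abs_le.2 ⟨by nlinarith, by nlinarith⟩

theorem exists_finite_supportingLines {α : ℝ} {F : ℝ → ℝ} (hconv : ConvexOn ℝ (Ioi α) F)
    {L : NNReal} (hLip : LipschitzOnWith L F (Ioi α)) {ε : ℝ} (hε : 0 < ε) (R : ℝ) :
    ∃ (N : ℕ) (a b : Fin N → ℝ), 0 < N ∧ (∀ i, IsSupportingLine F (Ioi α) (a i) (b i)) ∧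
      ∀ t ∈ Ioc α R, ∃ i, F t - ε ≤ a i * t + b i := by
  -- Grid spacing: over a distance `δ`, `F` and a supporting line drift apart by at most `2 * L *
  -- δ`; the `+ 1` covers `L = 0`.
  set δ : ℝ := ε / (2 * L + 1) with hδ
  have hL : (0 : ℝ) ≤ L := L.2
  have hδ0 : 0 < δ := by positivity
  have hδL : 2 * L * δ ≤ ε := by
    rw [hδ, mul_div_assoc', div_le_iff₀ (by positivity)]
    nlinarith
  have hpt : ∀ i : ℕ, α + δ * (i + 1) ∈ Ioi α := fun i =>
    lt_add_of_pos_right α (by positivity)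
  choose a b hab habe using fun i : ℕ => hconv.exists_isSupportingLine
    (x := α + δ * (i + 1)) (by rw [interior_Ioi]; exact hpt i)
  refine ⟨⌈(R - α) / δ⌉₊ + 1, fun i => a i, fun i => b i, by omega, fun i => hab i, ?_⟩
  intro t ht
  have h0 : 0 ≤ (t - α) / δ := div_nonneg (by linarith [ht.1]) hδ0.le
  have hi1 := Nat.floor_le h0
  have hi2 := Nat.lt_floor_add_one ((t - α) / δ)
  set i := ⌊(t - α) / δ⌋₊ with hi
  have hiN : i < ⌈(R - α) / δ⌉₊ + 1 := by
    have h1 : (t - α) / δ ≤ (R - α) / δ := by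
      gcongr
      exact ht.2
    have h2 : (i : ℝ) ≤ ⌈(R - α) / δ⌉₊ := hi1.trans (h1.trans (Nat.le_ceil _))
    have h3 : i ≤ ⌈(R - α) / δ⌉₊ := by exact_mod_cast h2
    omega
  refine ⟨⟨i, hiN⟩, ?_⟩
  rw [le_div_iff₀ hδ0] at hi1
  rw [div_lt_iff₀ hδ0] at hi2
  have hslope := (abs_le.1 ((hab i).abs_slope_le isOpen_Ioi hLip)).2
  have h1 := hLip.dist_le_mul t ht.1 _ (hpt i)
  rw [Real.dist_eq, Real.dist_eq, abs_sub_comm t] at h1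
  have hd0 : 0 ≤ α + δ * (i + 1) - t := by linarith
  have hd1 : α + δ * (i + 1) - t ≤ δ := by linarith
  rw [abs_of_nonneg hd0] at h1
  have h2 := (le_abs_self _).trans h1
  have h3 := habe i
  have h4 : (a i + L) * (α + δ * (i + 1) - t) ≤ 2 * L * δ := by
    calc (a i + L) * (α + δ * (i + 1) - t) ≤ (2 * L) * (α + δ * (i + 1) - t) :=
          mul_le_mul_of_nonneg_right (by linarith) hd0
      _ ≤ 2 * L * δ := by gcongr
  simp only
  nlinarith

theorem exists_markerFun_pressure_near {α : ℝ} (hα : 0 < α) {F : ℝ → ℝ}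
    (hconv : ConvexOn ℝ (Ioi α) F) {L : NNReal} (hLip : LipschitzOnWith L F (Ioi α))
    {γ₁ γ₂ : ℝ} (hγ₁ : 0 ≤ γ₁)
    (hsupp : ∀ a b : ℝ, IsSupportingLine F (Ioi α) a b → b ∈ Icc γ₁ γ₂)
    {q : ℕ} (hq : Real.exp (γ₂ + 1) ≤ q) {ε : ℝ} (hε : 0 < ε) (R : ℝ) :
    ∃ φ : LocallyConstant (ℤ → Fin (q + 1)) ℝ,
      (∀ t, HasPressure (fun x => t * φ x) (pressure fun x => t * φ x)) ∧
      (∀ t ∈ Ioi α, (pressure fun x => t * φ x) ≤ F t + ε) ∧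
      ∀ t ∈ Ioc α R, F t - ε ≤ pressure fun x => t * φ x := by
  obtain ⟨N, a, b, hN, hab, hnear⟩ := exists_finite_supportingLines hconv hLip hε R
  have hN' : (0 : ℝ) < N := by exact_mod_cast hN
  -- The first bound makes `q ^ k` marked words suffice; the second lets `ε` absorb the factor `4 *
  -- N` in the upper estimate.
  obtain ⟨k, hk⟩ := exists_nat_ge (max (Real.log (2 * N) + γ₂) (Real.log (4 * N) / ε))
  have hk1 := (le_max_left _ _).trans hk
  have hk2 := (le_max_right _ _).trans hk
  rw [div_le_iff₀ hε] at hk2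
  have hb0 : ∀ i, 0 ≤ b i := fun i => hγ₁.trans (hsupp _ _ (hab i)).1
  set n : Fin N → ℕ := fun i => ⌈Real.exp ((k + 1) * b i)⌉₊ with hn
  have hn1 : ∀ i, Real.exp ((k + 1) * b i) ≤ n i := fun i => Nat.le_ceil _
  -- Rounding up costs only a factor `2` because `b i ≥ 0`.
  have hn2 : ∀ i, (n i : ℝ) ≤ 2 * Real.exp ((k + 1) * b i) := fun i => by
    have h1 := (Nat.ceil_lt_add_one (Real.exp_pos ((k + 1) * b i)).le).le
    have h2 : 1 ≤ Real.exp ((k + 1) * b i) :=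
      Real.one_le_exp (mul_nonneg (by positivity) (hb0 i))
    simp only [hn]
    linarith
  have hcard : Fintype.card (Σ i, Fin (n i)) ≤ q ^ k := by
    simp only [Fintype.card_sigma, Fintype.card_fin]
    have h1 : ((∑ i, n i : ℕ) : ℝ) ≤ (q : ℝ) ^ k := by
      push_cast
      calc ∑ i, (n i : ℝ) ≤ ∑ _i : Fin N, 2 * Real.exp ((k + 1) * γ₂) := by
            refine Finset.sum_le_sum fun i _ => (hn2 i).trans ?_
            gcongr
            exact (hsupp _ _ (hab i)).2
        _ = Real.exp (Real.log (2 * N) + (k + 1) * γ₂) := by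
            rw [Real.exp_add, Real.exp_log (by positivity)]
            simp
            ring
        _ ≤ Real.exp (k * (γ₂ + 1)) := Real.exp_le_exp.2 (by linarith)
        _ = Real.exp (γ₂ + 1) ^ k := by rw [Real.exp_nat_mul]
        _ ≤ (q : ℝ) ^ k := by gcongr
    exact_mod_cast h1
  obtain ⟨G, s, hG, hsum⟩ := exists_marked_blockSum_eq hcard fun p => a p.1
  have hblock : ∀ t, blockSum G s t = ∑ i, n i * Real.exp (t * ((k + 1) * a i)) := fun t => by
    rw [hsum, Fintype.sum_sigma]
    simp
  -- The term `-L` puts `t * c` below `F t`, as `F t ≥ -L * t`; the other term beats the factor `2 *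
  -- (q + 1)` for every `t > α`, which is where `α > 0` enters.
  set c : ℝ := -L - Real.log (2 * (q + 1)) / α with hc
  refine ⟨markerFun G s c, hasPressure_markerFun, fun t ht => ?_, fun t ht => ?_⟩
  · have ht' : α < t := ht
    rw [← Real.log_exp (F t + ε)]
    refine pressure_markerFun_le hG (Real.exp_pos _) ?_
    have h1 : blockSum G s t ≤ 1 / 2 * Real.exp (F t + ε) ^ (k + 1) := by
      rw [hblock, ← Real.exp_nat_mul]
      calc ∑ i, n i * Real.exp (t * ((k + 1) * a i))
          ≤ ∑ _i : Fin N, 2 * Real.exp ((k + 1) * F t) := by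
            refine Finset.sum_le_sum fun i _ => ?_
            calc n i * Real.exp (t * ((k + 1) * a i))
                ≤ 2 * Real.exp ((k + 1) * b i) * Real.exp (t * ((k + 1) * a i)) := by
                  gcongr
                  exact hn2 i
              _ = 2 * Real.exp ((k + 1) * (a i * t + b i)) := by
                  rw [mul_assoc, ← Real.exp_add]
                  ring_nf
              _ ≤ 2 * Real.exp ((k + 1) * F t) := by
                  gcongr
                  exact (hab i).1 t ht
        _ = 1 / 2 * Real.exp (Real.log (4 * N) + (k + 1) * F t) := by
            rw [Real.exp_add, Real.exp_log (by positivity)]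
            simp
            ring
        _ ≤ 1 / 2 * Real.exp ((k + 1 : ℕ) * (F t + ε)) := by
            gcongr
            push_cast
            linarith
    have h2 : (q + 1) * Real.exp (t * c) ≤ 1 / 2 * Real.exp (F t + ε) := by
      have hlog : 0 ≤ Real.log (2 * (q + 1)) := Real.log_nonneg (by
        have : (0 : ℝ) ≤ q := q.cast_nonneg
        linarith)
      obtain ⟨a', b', hl, he⟩ := hconv.exists_isSupportingLine (x := t) (by rwa [interior_Ioi])
      have hb' := hγ₁.trans (hsupp _ _ hl).1
      have ha' := (abs_le.1 (hl.abs_slope_le isOpen_Ioi hLip)).1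
      -- At `t` the function equals `a' * t + b'` with `a' ≥ -L` and `b' ≥ 0`.
      have h3 : -L * t ≤ F t := by nlinarith
      have h4 : Real.log (2 * (q + 1)) ≤ t * (Real.log (2 * (q + 1)) / α) := by
        rw [mul_div_assoc', le_div_iff₀ hα]
        nlinarith
      calc (q + 1) * Real.exp (t * c)
          = 1 / 2 * Real.exp (Real.log (2 * (q + 1)) + t * c) := by
            rw [Real.exp_add, Real.exp_log (by positivity)]
            ring
        _ ≤ 1 / 2 * Real.exp (F t + ε) := by
            refine mul_le_mul_of_nonneg_left (Real.exp_le_exp.2 ?_) (by norm_num)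
            rw [hc, mul_sub]
            linarith
    calc blockSum G s t + (q + 1) * Real.exp (t * c) * Real.exp (F t + ε) ^ k
        ≤ 1 / 2 * Real.exp (F t + ε) ^ (k + 1) +
          1 / 2 * Real.exp (F t + ε) * Real.exp (F t + ε) ^ k := by gcongr
      _ = Real.exp (F t + ε) ^ (k + 1) := by ring
  · refine le_pressure_markerFun hG ?_
    obtain ⟨i, hi⟩ := hnear t ht
    rw [hblock]
    calc Real.exp ((k + 1) * (F t - ε)) ≤ Real.exp ((k + 1) * (a i * t + b i)) := by gcongr
      _ = Real.exp ((k + 1) * b i) * Real.exp (t * ((k + 1) * a i)) := by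
          rw [← Real.exp_add]
          ring_nf
      _ ≤ n i * Real.exp (t * ((k + 1) * a i)) := by
          gcongr
          exact hn1 i
      _ ≤ ∑ i, n i * Real.exp (t * ((k + 1) * a i)) :=
          Finset.single_le_sum (f := fun i => n i * Real.exp (t * ((k + 1) * a i)))
            (fun i _ => by positivity) (Finset.mem_univ i)

theorem mainTheorem6 (α : ℝ) (hα : 0 < α) (F : ℝ → ℝ)
    (hconv : ConvexOn ℝ (Set.Ioi α) F)
    (L : NNReal) (hLip : LipschitzOnWith L F (Set.Ioi α))
    (γ₁ γ₂ : ℝ) (hγ₁ : 0 ≤ γ₁) (hγ : γ₁ ≤ γ₂)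
    (hsupp : ∀ a b : ℝ, IsSupportingLine F (Set.Ioi α) a b → b ∈ Set.Icc γ₁ γ₂) :
    ∃ K : ℕ, 0 < K ∧ ∃ φ : ℕ → LocallyConstant (ℤ → Fin K) ℝ,
      (∀ (n : ℕ) (t : ℝ),
        HasPressure (fun x => t * φ n x) (pressure fun x => t * φ n x)) ∧
      (∀ t ∈ Set.Ioi α,
        Filter.Tendsto (fun n => pressure fun x => t * φ n x) Filter.atTop (nhds (F t))) ∧
      (∀ B : Set ℝ, B ⊆ Set.Ioi α → Bornology.IsBounded B →
        TendstoUniformlyOn (fun n t => pressure fun x => t * φ n x) F Filter.atTop B) := by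
  obtain ⟨q, hq⟩ := exists_nat_ge (Real.exp (γ₂ + 1))
  -- The error `1 / (n + 1)` shrinks while the window `(α, n]` eventually covers any bounded set.
  choose φ hφ hup hlow using fun n : ℕ => exists_markerFun_pressure_near hα hconv hLip hγ₁ hsupp hq
    (ε := 1 / ((n : ℝ) + 1)) (by positivity) (n : ℝ)
  have hunif : ∀ B : Set ℝ, B ⊆ Set.Ioi α → Bornology.IsBounded B →
      TendstoUniformlyOn (fun n t => pressure fun x => t * φ n x) F Filter.atTop B := by
    intro B hB hbd
    obtain ⟨R, hR⟩ := hbd.bddAbove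
    rw [Metric.tendstoUniformlyOn_iff]
    intro ε hε
    filter_upwards [tendsto_one_div_add_atTop_nhds_zero_nat.eventually_lt_const hε,
      tendsto_natCast_atTop_atTop.eventually_ge_atTop R] with n hn hnR t ht
    rw [Real.dist_eq, abs_sub_lt_iff]
    have h1 := hup n t (hB ht)
    have h2 := hlow n t ⟨hB ht, (hR ht).trans hnR⟩
    exact ⟨by linarith, by linarith⟩
  refine ⟨q + 1, q.succ_pos, φ, hφ, fun t ht => ?_, hunif⟩
  exact (hunif {t} (singleton_subset_iff.2 ht) Bornology.isBounded_singleton).tendsto_at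
    (mem_singleton t)
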